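/- There are $n$ anonymous agents, each supporting opinion Alpha, supporting opinion Beta, or being undecided; an assignment of states to the agents is a configuration. For a configuration $\mathbf{x}$ let $a(\mathbf{x})$ and $b(\mathbf{x})$ be the numbers of Alpha and Beta agents, and let $s(\mathbf{x})=a(\mathbf{x})-b(\mathbf{x})$ be the bias; opinion $j$ is the majority opinion if it has strictly more supporters than the other one. In the Undecided-State process with noise probability $p\in(0,1/2]$, in every round all agents act in parallel and independently: each agent $u$ pulls an agent $v$ (possibly itself) chosen uniformly at random and sees the state of $v$ with probability $1-2p$, and each of the two other states with probability $p$. If $u$ is undecided, it adopts the state it sees; if $u$ supports an opinion and sees the opposite opinion, it becomes undecided; otherwise it keeps its state. Let $\epsilon\in(0,1/6)$ be a constant, let $p=1/6-\epsilon$, and let $$\Delta=\left[\frac{2\sqrt{\epsilon}}{1+6\epsilon}\,n,\ \left(1-2\left(\frac{1-6\epsilon}{12}\right)^3\right)n\right].$$ There are constants $C,c,\lambda,\gamma>0$ and $N$, depending only on $\epsilon$, such that for every $n\ge N$ with $n\geq 1$ and every initial configuration $\mathbf{x}$ of $n$ agents (including the perfectly balanced ones), the Undecided-State process $(\mathbf{X}_t)_{t\ge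 0}$ with $\mathbf{X}_0=\mathbf{x}$ has the following property with probability at least $1-n^{-\gamma}$: there are a round $T\le C\log n$ and an opinion $j\in\{\text{Alpha},\text{Beta}\}$ such that, for every round $t$ with $T\le t\le T+c\,n^{\lambda}$, the majority opinion in $\mathbf{X}_t$ is $j$ and $|s(\mathbf{X}_t)|\in\Delta$. -/

import Mathlib

open MeasureTheory ProbabilityTheory

/-- The two opinions, Alpha and Beta. -/
inductive Opinion
  | alpha
  | beta
  deriving DecidableEq

instance : Fintype Opinion := ⟨{.alpha, .beta}, fun o => by cases o <;> decide⟩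

/-- The state of an agent: `none` is the undecided state, `some o` means supporting `o`. -/
abbrev AgentState := Option Opinion

/-- States are discrete: every set of states is measurable. -/
instance : MeasurableSpace AgentState := ⊤

instance : DiscreteMeasurableSpace AgentState := ⟨fun _ => trivial⟩

/-- The noiseless update rule: `usdUpdate own seen` is the new state of an agent in state `own`
that sees the state `seen`. -/
def usdUpdate : AgentState → AgentState → AgentState
  | none, seen => seen
  | some o, none => some o
  | some o, some o' => if o = o' then some o else none

/-- The admissible noise probabilities, the reals in `(0, 1/2]`. -/
abbrev NoiseProb := Set.Ioc (0 : ℝ) (1 / 2)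

/-- The state that is seen when pulling an agent in state `w`: it is `w` with probability
`1 - 2p`, and each of the two other states with probability `p`. -/
noncomputable def noisyView (p : NoiseProb) (w : AgentState) : PMF AgentState :=
  PMF.ofFintype (fun m => ENNReal.ofReal (if m = w then 1 - 2 * (p : ℝ) else p)) (by
    have h0 : 0 ≤ (p : ℝ) := p.2.1.le
    have h1 : 0 ≤ 1 - 2 * (p : ℝ) := by linarith [p.2.2]
    rw [← ENNReal.ofReal_sum_of_nonneg (fun m _ => by split_ifs <;> assumption),
      ENNReal.ofReal_eq_one, Finset.sum_ite, Finset.sum_const, Finset.sum_const]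
    have e1 : (Finset.univ.filter (fun m : AgentState => m = w)).card = 1 := by
      revert w; decide
    have e2 : (Finset.univ.filter (fun m : AgentState => ¬ m = w)).card = 2 := by
      revert w; decide
    rw [e1, e2]
    simp)

/-- A configuration of the agents in `V`: the state of every agent. -/
abbrev Config (V : Type) := V → AgentState

section Dynamics

variable {V : Type} [Fintype V]

/-- The number of agents in state `z`. -/
def stateCount (x : Config V) (z : AgentState) : ℕ :=
  (Finset.univ.filter (fun u => x u = z)).card

/-- The bias: the number of Alpha agents minus the number of Beta agents. -/
def bias (x : Config V) : ℤ :=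
  (stateCount x (some .alpha) : ℤ) - (stateCount x (some .beta) : ℤ)

/-- Opinion `j` is the majority opinion: it has strictly more supporters than the other one. -/
def IsMajority (j : Opinion) (x : Config V) : Prop :=
  ∀ k : Opinion, k ≠ j → stateCount x (some k) < stateCount x (some j)

variable [Nonempty V]

/-- The law of the next state of agent `u` in configuration `x`: `u` pulls a uniformly random
agent `v` (possibly itself), sees the state of `v` through the noise, and updates its state. -/
noncomputable def agentStep (p : NoiseProb) (x : Config V) (u : V) : PMF AgentState :=
  (PMF.uniformOfFintype V).bind fun v => (noisyView p (x v)).map (usdUpdate (x u))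

/-- The transition kernel of one round: all agents update in parallel, independently. -/
noncomputable def roundKernel (p : NoiseProb) : Kernel (Config V) (Config V) :=
  Kernel.ofFunOfCountable fun x => Measure.pi fun u => (agentStep p x u).toMeasure

instance (p : NoiseProb) : IsMarkovKernel (roundKernel (V := V) p) :=
  ⟨fun x => inferInstanceAs
    (IsProbabilityMeasure (Measure.pi fun u => (agentStep p x u).toMeasure))⟩

/-- The law, on trajectories `X : ℕ → Config V`, of the Undecided-State process with noise
probability `p` started from `x`: the Markov chain with `X 0 = x` and transitions
`roundKernel p`. -/
noncomputable def usdProcess (p : NoiseProb) (x : Config V) : Measure (ℕ → Config V) :=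
  Kernel.trajMeasure (X := fun _ => Config V) (Measure.dirac x)
    (fun t => (roundKernel p).comap
      (fun h : (i : Finset.Iic t) → Config V => h ⟨t, Finset.mem_Iic.2 le_rfl⟩)
      (measurable_pi_apply _))

end Dynamics

/-- The range `Δ` of the absolute value of the bias in the metastable phase, for `n` agents. -/
noncomputable def deltaRange (ε : ℝ) (n : ℕ) : Set ℝ :=
  Set.Icc (2 * Real.sqrt ε / (1 + 6 * ε) * n) ((1 - 2 * ((1 - 6 * ε) / 12) ^ 3) * n)

/-! Write s for the bias and w for the number of undecided agents, both per agent. In expectation a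
round sends s to s(1 - p + (1-3p)w) and w to 1/3 + (3(1-3p)/2)(w - 1/3)² - ((1-3p)/2)s². By
Chebyshev's inequality a round deviates from this map by more than a constant η with probability
O(1/n) only. If s is small, then after one round w is at least about 1/3, where the growth factor of
s is 1 + 2ε. Balance is therefore unstable, and the resulting lower bound on the growth factor stays
above 1 until |s| is about 4√ε/(1+6ε), twice the lower end of Δ.

Two facts carry the proof. Deterministically (`exists_time_metastable`), once |s| ≥ √ε/4, every
η-perturbed trajectory enters Δ within a constant number of rounds and stays there.
Probabilistically (`usdProcess_expandingUpTo_le`), symmetry breaks in O(log n) rounds: while the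
mean bias expands, the bias has variance of order n, so the potential `balance`, 1/(K + n s²),
shrinks in expectation by a constant factor per round (`integral_inv_add_sq_le`). Since it always
lies between 1/(K+n) and 1/K, this phase is unlikely to outlast a multiple of log n.

A union bound over about n^(1/2) rounds costs O(n^(-1/2)), which leaves room for γ = 1/4. -/

/-- The probability that a pulling agent sees the state `m` in configuration `x`. -/
noncomputable def seenProb {V : Type} [Fintype V] (p : NoiseProb) (x : Config V)
    (m : AgentState) : ℝ :=
  p + (1 - 3 * (p : ℝ)) * (stateCount x m / Fintype.card V)

/-! ### Expected bias and undecided fraction after one round. -/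

section Dynamics

variable {V : Type} [Fintype V] [Nonempty V]

/-- The law of the view does not depend on who pulls, so all agents share it and differ only in the
update map. -/
lemma agentStep_eq_map (p : NoiseProb) (x : Config V) (u : V) :
    agentStep p x u =
      ((PMF.uniformOfFintype V).bind fun v => noisyView p (x v)).map (usdUpdate (x u)) := by
  rw [agentStep, PMF.map_bind]

lemma toReal_uniform_bind_noisyView (p : NoiseProb) (x : Config V) (m : AgentState) :
    (((PMF.uniformOfFintype V).bind fun v => noisyView p (x v)) m).toReal = seenProb p x m := by
  have h0 : 0 ≤ (p : ℝ) := p.2.1.le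
  have h1 : 0 ≤ 1 - 2 * (p : ℝ) := by linarith [p.2.2]
  have hV : (Fintype.card V : ℝ) ≠ 0 := by positivity
  rw [PMF.bind_apply, tsum_fintype, ENNReal.toReal_sum]
  · have : ∀ v : V, ((PMF.uniformOfFintype V) v * (noisyView p (x v)) m).toReal
        = (Fintype.card V : ℝ)⁻¹ * (p + (1 - 3 * (p : ℝ)) * (if x v = m then 1 else 0)) := by
      intro v
      simp only [noisyView, PMF.uniformOfFintype_apply, PMF.ofFintype_apply, ENNReal.toReal_mul,
        ENNReal.toReal_inv, ENNReal.toReal_natCast]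
      rw [ENNReal.toReal_ofReal (by split_ifs <;> assumption)]
      by_cases h : x v = m
      · rw [if_pos h.symm, if_pos h]; ring
      · rw [if_neg (Ne.symm h), if_neg h]; ring
    simp_rw [this]
    rw [← Finset.mul_sum, Finset.sum_add_distrib, ← Finset.mul_sum, Finset.sum_boole,
      Finset.sum_const, Finset.card_univ, nsmul_eq_mul, seenProb, stateCount]
    field_simp
  · intro v _
    exact ENNReal.mul_ne_top (PMF.apply_ne_top _ _) (PMF.apply_ne_top _ _)

lemma integral_agentStep (p : NoiseProb) (x : Config V) (u : V) (φ : AgentState → ℝ) :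
    ∫ z, φ z ∂(agentStep p x u).toMeasure = ∑ m, seenProb p x m * φ (usdUpdate (x u) m) := by
  rw [agentStep_eq_map, ← PMF.toMeasure_map _ _ (measurable_of_countable _),
    integral_map (measurable_of_countable _).aemeasurable
      (measurable_of_countable _).aestronglyMeasurable, PMF.integral_eq_sum]
  simp only [toReal_uniform_bind_noisyView, smul_eq_mul]

lemma sum_agentState {M : Type*} [AddCommMonoid M] (f : AgentState → M) :
    ∑ m, f m = f none + (f (some .alpha) + f (some .beta)) := by
  rw [Fintype.sum_option]
  congr 1
  exact Finset.sum_pair (by decide)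

lemma sum_comp_state {V : Type} [Fintype V] (x : Config V) (f : AgentState → ℝ) :
    ∑ u, f (x u) = ∑ z, stateCount x z * f z := by
  rw [← Finset.sum_fiberwise (s := Finset.univ) (g := x)]
  refine Finset.sum_congr rfl fun z _ => ?_
  rw [Finset.sum_congr rfl (g := fun _ => f z) (by simp +contextual), Finset.sum_const,
    nsmul_eq_mul, stateCount]

lemma sum_stateCount {V : Type} [Fintype V] (x : Config V) :
    (stateCount x none : ℝ) + (stateCount x (some .alpha) + stateCount x (some .beta))
      = Fintype.card V := by
  have := sum_comp_state x (fun _ => 1)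
  rw [sum_agentState] at this
  simpa using this.symm

lemma le_seenProb {p : NoiseProb} (hp : (p : ℝ) ≤ 1 / 3) (x : Config V) (m : AgentState) :
    (p : ℝ) ≤ seenProb p x m := by
  have : 0 ≤ (1 - 3 * (p : ℝ)) * (stateCount x m / Fintype.card V) :=
    mul_nonneg (by linarith) (by positivity)
  unfold seenProb; linarith

/-- The sign carried by a state: `1` for Alpha, `-1` for Beta, `0` for undecided. -/
def stateSign : AgentState → ℝ
  | none => 0
  | some .alpha => 1
  | some .beta => -1

/-- The indicator of the undecided state. -/
def undecidedInd : AgentState → ℝ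
  | none => 1
  | some _ => 0

lemma abs_stateSign_le (z : AgentState) : |stateSign z| ≤ 1 := by
  rcases z with _ | (_ | _) <;> simp [stateSign]

lemma abs_undecidedInd_le (z : AgentState) : |undecidedInd z| ≤ 1 := by
  rcases z with _ | (_ | _) <;> simp [undecidedInd]

/-- The bias per agent. -/
noncomputable def relBias {V : Type} [Fintype V] (x : Config V) : ℝ :=
  (bias x : ℝ) / Fintype.card V

/-- The fraction of undecided agents. -/
noncomputable def relUndecided {V : Type} [Fintype V] (x : Config V) : ℝ :=
  (stateCount x none : ℝ) / Fintype.card V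

lemma sum_stateSign {V : Type} [Fintype V] (x : Config V) : ∑ u, stateSign (x u) = bias x := by
  rw [sum_comp_state, sum_agentState]
  simp [stateSign, bias]
  ring

lemma sum_undecidedInd {V : Type} [Fintype V] (x : Config V) :
    ∑ u, undecidedInd (x u) = stateCount x none := by
  rw [sum_comp_state, sum_agentState]
  simp [undecidedInd]

/-- The expected relative bias after one round, from relative bias `s` and undecided fraction
`w`. -/
noncomputable def driftBias (p s w : ℝ) : ℝ := s * (1 - p + (1 - 3 * p) * w)

/-- The expected undecided fraction after one round, from relative bias `s` and undecided
fraction `w`. -/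
noncomputable def driftUndecided (p s w : ℝ) : ℝ :=
  p + (1 - 3 * p) * w ^ 2 + (1 - 3 * p) / 2 * ((1 - w) ^ 2 - s ^ 2)

/-- The mean closes on the pair (bias, undecided fraction), which makes a two-dimensional mean-field
analysis possible. -/
lemma sum_integral_stateSign (p : NoiseProb) (x : Config V) :
    ∑ u, ∫ z, stateSign z ∂(agentStep p x u).toMeasure
      = Fintype.card V * driftBias p (relBias x) (relUndecided x) := by
  have hV : (Fintype.card V : ℝ) ≠ 0 := by positivity
  simp_rw [integral_agentStep]
  rw [sum_comp_state x (fun z => ∑ m, seenProb p x m * stateSign (usdUpdate z m))]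
  have h := sum_stateCount x
  simp only [sum_agentState, usdUpdate, stateSign, seenProb, driftBias, relBias, relUndecided, bias]
  simp only [if_true, reduceCtorEq, if_false]
  push_cast
  have ha : (stateCount x (some .alpha) : ℝ) =
    Fintype.card V - stateCount x none - stateCount x (some .beta) := by linarith
  rw [ha]
  field_simp
  ring

lemma sum_integral_undecidedInd (p : NoiseProb) (x : Config V) :
    ∑ u, ∫ z, undecidedInd z ∂(agentStep p x u).toMeasure
      = Fintype.card V * driftUndecided p (relBias x) (relUndecided x) := by
  have hV : (Fintype.card V : ℝ) ≠ 0 := by positivity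
  simp_rw [integral_agentStep]
  rw [sum_comp_state x (fun z => ∑ m, seenProb p x m * undecidedInd (usdUpdate z m))]
  have h := sum_stateCount x
  simp only [sum_agentState, usdUpdate, undecidedInd, seenProb, driftUndecided, relBias,
    relUndecided, bias]
  simp only [if_true, reduceCtorEq, if_false]
  push_cast
  have ha : (stateCount x (some .alpha) : ℝ) =
    Fintype.card V - stateCount x none - stateCount x (some .beta) := by linarith
  rw [ha]
  field_simp
  ring

lemma relUndecided_nonneg {V : Type} [Fintype V] (x : Config V) : 0 ≤ relUndecided x := by
  unfold relUndecided; positivity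

lemma abs_relBias_le (x : Config V) : |relBias x| ≤ 1 - relUndecided x := by
  have hV : (0 : ℝ) < Fintype.card V := by positivity
  have h := sum_stateCount x
  rw [relBias, relUndecided, abs_div, abs_of_pos hV, div_le_iff₀ hV, sub_mul, div_mul_cancel₀ _ hV.ne']
  rw [bias]; push_cast
  have h1 : (0 : ℝ) ≤ stateCount x (some .alpha) := by positivity
  have h2 : (0 : ℝ) ≤ stateCount x (some .beta) := by positivity
  rw [abs_le]; constructor <;> linarith

end Dynamics

/-! ### Moments and deviations of sums of independent bounded terms. -/

lemma variance_le_one_of_abs_le_one {E : Type*} [Finite E] [MeasurableSpace E]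
    [MeasurableSingletonClass E] {μ : Measure E} [IsProbabilityMeasure μ] {φ : E → ℝ}
    (hφ : ∀ z, |φ z| ≤ 1) : Var[φ; μ] ≤ 1 := by
  refine (variance_le_expectation_sq (measurable_of_finite _).aestronglyMeasurable).trans ?_
  calc ∫ z, (φ ^ 2) z ∂μ ≤ ∫ _, (1 : ℝ) ∂μ := by
        refine integral_mono Integrable.of_finite (integrable_const _) fun z => ?_
        simpa using hφ z
    _ = 1 := by simp

section ProductSums

variable {ι E : Type*} [Fintype ι] [Finite E] [MeasurableSpace E] [MeasurableSingletonClass E]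
  {μ : ι → Measure E} [∀ i, IsProbabilityMeasure (μ i)] {φ : E → ℝ}

lemma integral_sum_pi (φ : E → ℝ) :
    ∫ y : ι → E, ∑ i, φ (y i) ∂Measure.pi μ = ∑ i, ∫ z, φ z ∂μ i := by
  rw [integral_finsetSum _ fun i _ => Integrable.of_finite]
  exact Finset.sum_congr rfl fun i _ =>
    integral_comp_eval (measurable_of_finite _).aestronglyMeasurable

lemma variance_sum_pi_eq (φ : E → ℝ) :
    Var[fun y : ι → E => ∑ i, φ (y i); Measure.pi μ] = ∑ i, Var[φ; μ i] := by
  rw [← variance_sum_pi fun i => MemLp.of_discrete]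
  congr 1
  ext y
  simp

lemma variance_sum_pi_le (hφ : ∀ z, |φ z| ≤ 1) :
    Var[fun y : ι → E => ∑ i, φ (y i); Measure.pi μ] ≤ Fintype.card ι := by
  rw [variance_sum_pi_eq]
  refine (Finset.sum_le_sum fun i _ => variance_le_one_of_abs_le_one hφ).trans ?_
  simp

lemma measure_sum_pi_deviation_le [Nonempty ι] (hφ : ∀ z, |φ z| ≤ 1) {η : ℝ} (hη : 0 < η) :
    Measure.pi μ {y : ι → E | η * Fintype.card ι ≤ |∑ i, φ (y i) - ∑ i, ∫ z, φ z ∂μ i|} ≤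
      ENNReal.ofReal (1 / (η ^ 2 * Fintype.card ι)) := by
  have hV : (0 : ℝ) < Fintype.card ι := by positivity
  have h := meas_ge_le_variance_div_sq (μ := Measure.pi μ)
    (X := fun y : ι → E => ∑ i, φ (y i)) MemLp.of_discrete (mul_pos hη hV)
  rw [integral_sum_pi] at h
  refine h.trans (ENNReal.ofReal_le_ofReal ?_)
  rw [div_le_div_iff₀ (by positivity) (by positivity)]
  have := variance_sum_pi_le (μ := μ) hφ
  have h2 : 0 ≤ η ^ 2 * (Fintype.card ι : ℝ) := by positivity
  nlinarith

lemma pow_four_le_exp (x : ℝ) : x ^ 4 ≤ 24 * (Real.exp x + Real.exp (-x)) := by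
  have key : ∀ y : ℝ, 0 ≤ y → y ^ 4 ≤ 24 * Real.exp y := fun y hy => by
    have := Real.pow_div_factorial_le_exp y hy 4
    rw [div_le_iff₀ (by positivity)] at this
    norm_num [Nat.factorial] at this
    linarith
  rcases le_total 0 x with h | h
  · have := key x h
    have := Real.exp_pos (-x)
    linarith
  · have h4 := key (-x) (by linarith)
    have := Real.exp_pos x
    have e : (-x) ^ 4 = x ^ 4 := by ring
    linarith

/-- Hoeffding's lemma bounds the exponential moments at ±1/√n by e^(1/2) ≤ 2; dominating x⁴ by
exponentials then gives 24 · (2 + 2) = 96. -/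
lemma integral_pow_four_sum_pi_le [Nonempty ι] (hφ : ∀ z, |φ z| ≤ 1) :
    ∫ y : ι → E, ((∑ i, φ (y i) - ∑ i, ∫ z, φ z ∂μ i) / √(Fintype.card ι)) ^ 4 ∂Measure.pi μ
      ≤ 96 := by
  have hV : (0 : ℝ) < Fintype.card ι := by positivity
  have hs : HasSubgaussianMGF (fun y : ι → E => ∑ i, (φ (y i) - ∫ z, φ z ∂μ i))
      (∑ _i : ι, 1) (Measure.pi μ) := by
    refine HasSubgaussianMGF.sum_of_iIndepFun
      (iIndepFun_pi (X := fun i z => φ z - ∫ z, φ z ∂μ i)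
        fun i => (measurable_of_finite _).aemeasurable) fun i _ => ?_
    have h := hasSubgaussianMGF_of_mem_Icc (μ := Measure.pi μ) (X := fun y : ι → E => φ (y i))
      (a := -1) (b := 1) (measurable_of_finite _).aemeasurable
      (ae_of_all _ fun y => abs_le.1 (hφ (y i)))
    rw [integral_comp_eval (measurable_of_finite _).aestronglyMeasurable] at h
    convert h using 1
    ext
    norm_num
  set c : ℝ := (√(Fintype.card ι))⁻¹ with hc
  have hc2 : c ^ 2 * Fintype.card ι = 1 := by
    rw [hc, inv_pow, Real.sq_sqrt hV.le, inv_mul_cancel₀ hV.ne']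
  have hexp : Real.exp (1 / 2) ≤ 2 := by
    have h1 : Real.exp (1 / 2) * Real.exp (1 / 2) = Real.exp 1 := by
      rw [← Real.exp_add]; norm_num
    have := Real.exp_one_lt_d9
    nlinarith [Real.exp_pos (1 / 2)]
  have hm : ∀ t : ℝ, t ^ 2 = c ^ 2 →
      ∫ y : ι → E, Real.exp (t * ∑ i, (φ (y i) - ∫ z, φ z ∂μ i)) ∂Measure.pi μ ≤ 2 := by
    intro t ht
    refine (hs.mgf_le t).trans (le_trans (le_of_eq ?_) hexp)
    congr 1
    rw [ht]
    push_cast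
    rw [Finset.sum_const, Finset.card_univ, nsmul_eq_mul]
    linear_combination hc2 / 2
  have h1 := hm c rfl
  have h2 := hm (-c) (by ring)
  calc _ ≤ ∫ y : ι → E, 24 * (Real.exp (c * ∑ i, (φ (y i) - ∫ z, φ z ∂μ i)) +
        Real.exp (-c * ∑ i, (φ (y i) - ∫ z, φ z ∂μ i))) ∂Measure.pi μ := by
        refine integral_mono Integrable.of_finite Integrable.of_finite fun y => ?_
        refine (pow_four_le_exp _).trans (le_of_eq ?_)
        simp only [Finset.sum_sub_distrib, hc, div_eq_mul_inv]
        ring_nf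
    _ ≤ 96 := by
        rw [integral_const_mul, integral_add Integrable.of_finite Integrable.of_finite]
        linarith

end ProductSums

/-! ### The Lyapunov inequality for symmetry breaking. -/

/-- Drift of the rational Lyapunov function `y ↦ 1 / (K + y²)`: it contracts in expectation when
the mean is expanded and the centred noise `Y` has non-degenerate variance. -/
lemma integral_inv_add_sq_le {Ω : Type*} [Finite Ω] [MeasurableSpace Ω]
    [MeasurableSingletonClass Ω] {ν : Measure Ω} [IsProbabilityMeasure ν] {Y : Ω → ℝ}
    {x μ e K σ m v : ℝ} (hY : ∫ ω, Y ω ∂ν = 0) (hv : ∫ ω, Y ω ^ 2 ∂ν = v)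
    (hσ : 0 ≤ σ) (hσv : σ ≤ v) (hv1 : v ≤ 1) (hm : ∫ ω, Y ω ^ 4 ∂ν ≤ m)
    (he : 0 < e) (he1 : e ≤ 1) (hx : x ^ 2 ≤ (1 - e) * μ ^ 2)
    (hK : 32 ≤ e * K) (hKm : 4 * m ≤ σ * K) :
    ∫ ω, 1 / (K + (μ + Y ω) ^ 2) ∂ν ≤ (1 - min (σ / (2 * K)) (e / 2)) * (1 / (K + x ^ 2)) := by
  have hK0 : 0 < K := by nlinarith
  have hK32 : 32 ≤ K := by nlinarith
  set A := K + μ ^ 2 with hA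
  have hA0 : 0 < A := by positivity
  have hpt : ∀ ω, 1 / (K + (μ + Y ω) ^ 2) ≤
      1 / A - (2 * μ * Y ω + Y ω ^ 2) / A ^ 2 + (8 * μ ^ 2 * Y ω ^ 2 + 2 * Y ω ^ 4) / (A ^ 2 * K) := by
    intro ω
    set y := Y ω
    set z := K + (μ + y) ^ 2 with hz
    have hz0 : K ≤ z := by nlinarith [sq_nonneg (μ + y)]
    have hzp : 0 < z := by linarith
    have hD : z = A + (2 * μ * y + y ^ 2) := by rw [hz, hA]; ring
    set D := 2 * μ * y + y ^ 2 with hDd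
    -- Exact second-order expansion of 1/z at A. As z ≥ K, a large K makes the remainder negligible
    -- against the gain -v/A² of the linear term.
    have e1 : 1 / z = 1 / A - D / A ^ 2 + D ^ 2 / (A ^ 2 * z) := by
      have : A + D ≠ 0 := by rw [← hD]; exact hzp.ne'
      rw [hD]; field_simp; ring
    rw [e1]
    have e2 : D ^ 2 / (A ^ 2 * z) ≤ (8 * μ ^ 2 * y ^ 2 + 2 * y ^ 4) / (A ^ 2 * K) := by
      have hD2 : D ^ 2 ≤ 8 * μ ^ 2 * y ^ 2 + 2 * y ^ 4 := by
        rw [hDd]; nlinarith [sq_nonneg (2 * μ * y - y ^ 2)]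
      gcongr
    linarith
  have hint : ∫ ω, 1 / (K + (μ + Y ω) ^ 2) ∂ν ≤
      1 / A - v / A ^ 2 + (8 * μ ^ 2 * v + 2 * m) / (A ^ 2 * K) := by
    refine (integral_mono Integrable.of_finite Integrable.of_finite hpt).trans ?_
    rw [integral_add Integrable.of_finite Integrable.of_finite,
      integral_sub Integrable.of_finite Integrable.of_finite, integral_div, integral_div, integral_div,
      integral_add Integrable.of_finite Integrable.of_finite,
      integral_add Integrable.of_finite Integrable.of_finite, integral_const_mul,
      integral_const_mul, integral_const_mul, hY, hv, integral_const]
    simp only [probReal_univ, smul_eq_mul, mul_zero, zero_add, one_mul]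
    gcongr
  refine hint.trans ?_
  have hx0 : 0 < K + x ^ 2 := by positivity
  -- The first entry is the gain from the variance, decisive when μ is small; the second is the gain
  -- from expansion, decisive when μ² is large compared with K.
  set c := min (σ / (2 * K)) (e / 2) with hc
  have hc1 : c * K ≤ σ / 2 := by
    have : c ≤ σ / (2 * K) := min_le_left _ _
    rw [le_div_iff₀ (by positivity)] at this
    linarith
  have hc2 : c ≤ e / 2 := min_le_right _ _
  have hc0 : 0 ≤ c := by rw [hc]; exact le_min (by positivity) (by positivity)
  have hB : 1 / A - v / A ^ 2 + (8 * μ ^ 2 * v + 2 * m) / (A ^ 2 * K)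
      ≤ (A - σ / 2 + e * μ ^ 2 / 4) / A ^ 2 := by
    have h3 : (8 * μ ^ 2 * v + 2 * m) / K ≤ e * μ ^ 2 / 4 + σ / 2 := by
      rw [div_le_iff₀ hK0]
      nlinarith [sq_nonneg μ, mul_nonneg (sq_nonneg μ) (sub_nonneg.2 hv1),
        mul_nonneg (sq_nonneg μ) (sub_nonneg.2 hK)]
    have h4 : 1 / A - v / A ^ 2 + (8 * μ ^ 2 * v + 2 * m) / (A ^ 2 * K)
        = (A - v + (8 * μ ^ 2 * v + 2 * m) / K) / A ^ 2 := by field_simp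
    rw [h4]
    exact div_le_div_of_nonneg_right (by linarith) (by positivity)
  refine hB.trans ?_
  rw [mul_one_div, div_le_div_iff₀ (by positivity) hx0]
  have hM : 0 ≤ μ ^ 2 := sq_nonneg μ
  set M := μ ^ 2
  have hxA : K + x ^ 2 ≤ A - e * M := by rw [hA]; linarith
  have hpos : 0 ≤ A - σ / 2 + e * M / 4 := by
    have : 0 ≤ e * M := by positivity
    linarith
  have hmain : (A - σ / 2 + e * M / 4) * (A - e * M) ≤ (1 - c) * A ^ 2 := by
    have heM : 0 ≤ e * M := by positivity
    have h5 : c * A ≤ σ / 2 + e * M / 2 := by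
      rw [hA]; nlinarith [mul_le_mul_of_nonneg_right hc2 hM]
    have h6 : σ / 2 * (e * M) ≤ A * (e * M) / 4 := by
      have : σ / 2 ≤ A / 4 := by linarith
      nlinarith
    have h7 : A * (c * A) ≤ A * (σ / 2 + e * M / 2) := mul_le_mul_of_nonneg_left h5 hA0.le
    nlinarith [mul_nonneg heM heM]
  exact (mul_le_mul_of_nonneg_left hxA hpos).trans hmain

/-! ### The perturbed mean-field dynamics. -/

/-- Completing the square at 1/3, the fixed point for zero bias whatever p is. Dropping the square
bounds the next undecided fraction from below in terms of s alone. -/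
lemma driftUndecided_eq (p s w : ℝ) : driftUndecided p s w =
    1 / 3 + 3 * (1 - 3 * p) / 2 * (w - 1 / 3) ^ 2 - (1 - 3 * p) / 2 * s ^ 2 := by
  unfold driftUndecided; ring

lemma driftUndecided_neg (p s w : ℝ) : driftUndecided p (-s) w = driftUndecided p s w := by
  unfold driftUndecided; ring

lemma driftBias_neg (p s w : ℝ) : driftBias p (-s) w = -driftBias p s w := by
  unfold driftBias; ring

/-- One perturbed round of the mean-field dynamics, with errors at most `η`. -/
def NearDrift (p η s w s' w' : ℝ) : Prop :=
  |s' - driftBias p s w| ≤ η ∧ |w' - driftUndecided p s w| ≤ η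

lemma NearDrift.neg {p η s w s' w' : ℝ} (h : NearDrift p η s w s' w') :
    NearDrift p η (-s) w (-s') w' := by
  refine ⟨?_, ?_⟩
  · rw [driftBias_neg, neg_sub_neg, abs_sub_comm]; exact h.1
  · rw [driftUndecided_neg]; exact h.2

/-- The noise level tolerated by the analysis of the perturbed mean-field dynamics. -/
noncomputable def noiseTol (ε : ℝ) : ℝ := min (ε * √ε / 200) ((1 - 6 * ε) / 12)

section Deterministic

variable {ε : ℝ}

lemma noiseTol_pos (h0 : 0 < ε) (h6 : ε < 1 / 6) : 0 < noiseTol ε :=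
  lt_min (by positivity) (by linarith)

/-- The growth factor of the bias is controlled from below by the bias one round earlier. -/
lemma growth_ge (h0 : 0 < ε) (h6 : ε < 1 / 6) {s w s' w' : ℝ}
    (h : NearDrift (1 / 6 - ε) (noiseTol ε) s w s' w') :
    1 + 2 * ε - (1 + 6 * ε) ^ 2 * s ^ 2 / 8 - noiseTol ε ≤
      1 - (1 / 6 - ε) + (1 - 3 * (1 / 6 - ε)) * w' := by
  have hη := noiseTol_pos h0 h6
  have h2 := (abs_le.1 h.2).1
  rw [driftUndecided_eq] at h2
  have hw : 1 / 3 - (1 + 6 * ε) / 4 * s ^ 2 - noiseTol ε ≤ w' := by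
    nlinarith [sq_nonneg (w - 1 / 3)]
  nlinarith

/-- As s² ≤ (1-w)², the terms added to p in the drift are nonnegative. -/
lemma undecided_ge (h0 : 0 < ε) {s w s' w' : ℝ} (hs : |s| ≤ 1 - w)
    (h : NearDrift (1 / 6 - ε) (noiseTol ε) s w s' w') : 1 / 6 - ε - noiseTol ε ≤ w' := by
  have h2 := (abs_le.1 h.2).1
  have hsq : s ^ 2 ≤ (1 - w) ^ 2 := sq_le_sq' (by linarith [(abs_le.1 hs).1]) (abs_le.1 hs).2
  unfold driftUndecided at h2
  nlinarith [sq_nonneg w]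

lemma sqrt_facts (h0 : 0 < ε) (h6 : ε < 1 / 6) :
    0 < √ε ∧ √ε < 1 / 2 ∧ √ε ^ 2 = ε ∧ noiseTol ε ≤ ε * √ε / 200 := by
  refine ⟨Real.sqrt_pos.2 h0, ?_, Real.sq_sqrt h0.le, min_le_left _ _⟩
  rw [Real.sqrt_lt' (by norm_num)]; linarith

/-- Over two rounds, either the bias is far above the lower end of `Δ`, or it grows. -/
lemma two_rounds (h0 : 0 < ε) (h6 : ε < 1 / 6) {s w s₁ w₁ s₂ w₂ : ℝ}
    (h : NearDrift (1 / 6 - ε) (noiseTol ε) s w s₁ w₁)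
    (h₁ : NearDrift (1 / 6 - ε) (noiseTol ε) s₁ w₁ s₂ w₂)
    (hw : 1 / 6 - ε - noiseTol ε ≤ w) (hw₁ : 1 / 6 - ε - noiseTol ε ≤ w₁)
    (hs : 0 ≤ s) (hs₁ : √ε / 8 ≤ s₁) :
    min (3 * √ε / (1 + 6 * ε)) ((1 + ε / 10) * s₁) ≤ s₂ := by
  obtain ⟨hr0, hr2, hrr, hη⟩ := sqrt_facts h0 h6
  have hηp := noiseTol_pos h0 h6
  set η := noiseTol ε with hηd
  set r := √ε with hr
  have hb := (abs_le.1 h.1).1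
  have hb₁ := (abs_le.1 h₁.1).1
  unfold driftBias at hb hb₁
  have hηs : η ≤ r / 1200 := hη.trans (by nlinarith)
  have h16 : (0 : ℝ) < 1 + 6 * ε := by linarith
  -- The threshold is just below the value 4√ε/(1+6ε) at which growth may stop. Above it, two rounds
  -- lose at most a factor of about (11/12)², and (15/4)(11/12)² > 3. Below it, the growth factor of
  -- the second round is at least 1 + 0.24ε - η.
  rcases le_total (15 / 4 * r / (1 + 6 * ε)) s with hc | hc
  · refine (min_le_left _ _).trans ?_
    have hfac : ∀ v, 1 / 6 - ε - η ≤ v →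
        11 / 12 - η ≤ 1 - (1 / 6 - ε) + (1 - 3 * (1 / 6 - ε)) * v := by
      intro v hv
      nlinarith [mul_le_mul_of_nonneg_left hv (by linarith : (0 : ℝ) ≤ 1 - 3 * (1 / 6 - ε))]
    have f := hfac w hw
    have f₁ := hfac w₁ hw₁
    have hd0 : r / 2 ≤ r / (1 + 6 * ε) := by
      gcongr; linarith
    set d := r / (1 + 6 * ε) with hd
    have e1 : 15 / 4 * r / (1 + 6 * ε) = 15 / 4 * d := by rw [hd]; ring
    have e2 : 3 * r / (1 + 6 * ε) = 3 * d := by rw [hd]; ring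
    rw [e1] at hc
    rw [e2]
    have hηd' : η ≤ d / 600 := by linarith
    have hη1 : η ≤ 1 / 2400 := by linarith
    have g1 : (11 / 12 - 1 / 2400) * s - η ≤ s₁ := by nlinarith
    have g2 : (11 / 12 - 1 / 2400) * s₁ - η ≤ s₂ := by nlinarith
    linarith
  · refine (min_le_right _ _).trans ?_
    have g := growth_ge h0 h6 h
    have hsq : (1 + 6 * ε) ^ 2 * s ^ 2 ≤ 225 / 16 * ε := by
      rw [le_div_iff₀ h16] at hc
      have : (s * (1 + 6 * ε)) ^ 2 ≤ (15 / 4 * r) ^ 2 := by gcongr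
      nlinarith
    have g' : 1 + 24 / 100 * ε - η ≤ 1 - (1 / 6 - ε) + (1 - 3 * (1 / 6 - ε)) * w₁ := by
      linarith
    have hs₁0 : 0 < s₁ := by linarith
    have g2 : (1 + 24 / 100 * ε - η) * s₁ - η ≤ s₂ := by
      have := mul_le_mul_of_nonneg_right g' hs₁0.le
      linarith
    have hη2 : η ≤ ε / 400 := hη.trans (by nlinarith)
    -- The 200 in `noiseTol` is 25 · 8: with s₁ ≥ √ε/8 the additive error becomes a small
    -- multiplicative one.
    have hη3 : η ≤ ε / 25 * s₁ := hη.trans (by nlinarith)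
    nlinarith

/-- While the relative bias is small, the bias expands by a factor at least `1 + ε`. -/
lemma growth_small (h0 : 0 < ε) (h6 : ε < 1 / 6) {s w s' w' : ℝ} (hs : |s| ≤ √ε / 4)
    (h : NearDrift (1 / 6 - ε) (noiseTol ε) s w s' w') :
    s' ^ 2 ≤ (1 - ε) * driftBias (1 / 6 - ε) s' w' ^ 2 := by
  obtain ⟨hr0, hr2, hrr, hη⟩ := sqrt_facts h0 h6
  have g := growth_ge h0 h6 h
  have hsq : s ^ 2 ≤ ε / 16 := by
    have := sq_le_sq' (by linarith [(abs_le.1 hs).1]) (abs_le.1 hs).2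
    rw [div_pow, hrr] at this
    linarith
  have hη2 : noiseTol ε ≤ ε / 400 := hη.trans (by nlinarith)
  have hg : 1 + ε ≤ 1 - (1 / 6 - ε) + (1 - 3 * (1 / 6 - ε)) * w' := by
    have : (1 + 6 * ε) ^ 2 * s ^ 2 ≤ 4 * (ε / 16) := by
      apply mul_le_mul _ hsq (sq_nonneg _) (by norm_num)
      nlinarith
    linarith
  unfold driftBias
  set g' := 1 - (1 / 6 - ε) + (1 - 3 * (1 / 6 - ε)) * w'
  have hg2 : 1 ≤ (1 - ε) * g' ^ 2 := by
    have : (1 + ε) ^ 2 ≤ g' ^ 2 := by gcongr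
    have h1 := mul_le_mul_of_nonneg_left this (by linarith : 0 ≤ 1 - ε)
    nlinarith [mul_pos h0 h0, mul_pos h0 (sub_pos.2 h6), mul_pos (mul_pos h0 h0) (sub_pos.2 h6)]
  rw [mul_pow]
  nlinarith [mul_le_mul_of_nonneg_left hg2 (sq_nonneg s')]

/-- The perturbed mean-field dynamics started with a relative bias of at least `√ε / 4` enters the
metastable range after a number of rounds that depends only on `ε`, and stays there. -/
lemma exists_time_metastable (h0 : 0 < ε) (h6 : ε < 1 / 6) :
    ∃ T₀ : ℕ, ∀ (H : ℕ) (s w : ℕ → ℝ), √ε / 4 ≤ s 0 → (∀ t, 0 ≤ w t) →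
      (∀ t, |s t| ≤ 1 - w t) →
      (∀ t < H, NearDrift (1 / 6 - ε) (noiseTol ε) (s t) (w t) (s (t + 1)) (w (t + 1))) →
      ∀ t, T₀ ≤ t → t ≤ H → 2 * √ε / (1 + 6 * ε) ≤ s t ∧
        s t ≤ 1 - 2 * ((1 - 6 * ε) / 12) ^ 3 := by
  obtain ⟨hr0, hr2, hrr, hη⟩ := sqrt_facts h0 h6
  have hηp := noiseTol_pos h0 h6
  -- Growth by 24 lifts √ε/8 to 3√ε, beyond the lower end of Δ.
  obtain ⟨m, hm⟩ := pow_unbounded_of_one_lt (24 : ℝ) (by linarith : 1 < 1 + ε / 10)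
  refine ⟨m + 2, fun H s w hs0 hw0 hsw hstep t ht htH => ?_⟩
  have hηs : noiseTol ε ≤ √ε / 1200 := hη.trans (by nlinarith)
  have hw : ∀ t, 1 ≤ t → t ≤ H → 1 / 6 - ε - noiseTol ε ≤ w t := by
    intro t h1 hH
    obtain ⟨t, rfl⟩ := Nat.exists_eq_succ_of_ne_zero (by omega : t ≠ 0)
    exact undecided_ge h0 (hsw t) (hstep t (by omega))
  have hdrop : ∀ t < H, 0 ≤ s t → 5 / 6 * s t - noiseTol ε ≤ s (t + 1) := by
    intro t hH hs
    have hb := (abs_le.1 (hstep t hH).1).1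
    unfold driftBias at hb
    have : 0 ≤ s t * ((1 - 3 * (1 / 6 - ε)) * w t) :=
      mul_nonneg hs (mul_nonneg (by linarith) (hw0 t))
    nlinarith [mul_nonneg hs h0.le]
  -- The initial undecided fraction may be zero, so the bias may shrink at first; two rounds keep at
  -- least half of it.
  have hs1 : 3 / 4 * (√ε / 4) ≤ s 1 := by
    have := hdrop 0 (by omega) (by linarith)
    simp only [zero_add] at this
    linarith
  have hs2 : √ε / 8 ≤ s 2 := by
    have := hdrop 1 (by omega) (by linarith)
    norm_num at this
    linarith
  have hM : √ε / 8 ≤ 3 * √ε / (1 + 6 * ε) := by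
    rw [le_div_iff₀ (by linarith)]; nlinarith
  have key : ∀ k, k + 2 ≤ H → √ε / 8 ≤ s (k + 1) ∧
      min (3 * √ε / (1 + 6 * ε)) ((1 + ε / 10) ^ k * (√ε / 8)) ≤ s (k + 2) := by
    intro k
    induction k with
    | zero =>
      intro _
      refine ⟨by simpa using by linarith, (min_le_right _ _).trans ?_⟩
      simpa using hs2
    | succ k ih =>
      intro hk
      obtain ⟨ih1, ih2⟩ := ih (by omega)
      have hpow : 1 ≤ (1 + ε / 10) ^ k := one_le_pow₀ (by linarith)
      have hk2 : √ε / 8 ≤ s (k + 2) := by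
        refine le_trans (le_min hM ?_) ih2
        nlinarith
      refine ⟨hk2, ?_⟩
      have h2 := two_rounds h0 h6 (hstep (k + 1) (by omega)) (hstep (k + 2) (by omega))
        (hw _ (by omega) (by omega)) (hw _ (by omega) (by omega)) (by linarith) hk2
      refine le_trans (le_min (min_le_left _ _) ?_) h2
      rcases le_total (3 * √ε / (1 + 6 * ε)) ((1 + ε / 10) ^ k * (√ε / 8)) with hc | hc
      · rw [min_eq_left hc] at ih2
        refine (min_le_left _ _).trans ?_
        nlinarith [mul_nonneg h0.le (by linarith : 0 ≤ s (k + 2))]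
      · rw [min_eq_right hc] at ih2
        refine (min_le_right _ _).trans ?_
        rw [pow_succ]
        nlinarith
  obtain ⟨k, rfl⟩ := Nat.exists_eq_add_of_le ht
  constructor
  · have h2 := (key (m + k) (by omega)).2
    have e : m + 2 + k = m + k + 2 := by ring
    rw [e]
    refine le_trans (le_min ?_ ?_) h2
    · gcongr; norm_num
    · have hp : (24 : ℝ) ≤ (1 + ε / 10) ^ (m + k) :=
        hm.le.trans (pow_le_pow_right₀ (by linarith) (by omega))
      have : 2 * √ε / (1 + 6 * ε) ≤ 2 * √ε := div_le_self (by linarith) (by linarith)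
      nlinarith
  · have hwt := hw (m + 2 + k) (by omega) htH
    have hst := (abs_le.1 (hsw (m + 2 + k))).2
    have hpos : 0 < 1 - 6 * ε := by linarith
    -- The upper end of Δ comes from s ≤ 1 - w, as the undecided fraction is at least (1-6ε)/12.
    have hη' : noiseTol ε ≤ (1 - 6 * ε) / 12 := min_le_right _ _
    have hc : ((1 - 6 * ε) / 12) ^ 3 ≤ (1 - 6 * ε) / 12 * (1 / 144) := by
      rw [pow_succ']
      gcongr
      have : ((1 - 6 * ε) / 12) ^ 2 ≤ (1 / 12) ^ 2 := by gcongr; linarith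
      linarith
    linarith

end Deterministic

/-! ### One random round: variance, typicality, decay of the potential. -/

section Dynamics

variable {V : Type} [Fintype V] [Nonempty V]

lemma roundKernel_apply (p : NoiseProb) (x : Config V) :
    roundKernel p x = Measure.pi fun u => (agentStep p x u).toMeasure := rfl

/-- Noise shows each state with probability at least p, so the new sign takes two values at distance
1 with probability at least p each; for any centre c, c² + (1-c)² ≥ 1/2. -/
lemma le_variance_stateSign {p : NoiseProb} (hp : (p : ℝ) ≤ 1 / 3) (x : Config V) (u : V) :
    (p : ℝ) / 2 ≤ Var[stateSign; (agentStep p x u).toMeasure] := by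
  have h0 : 0 < (p : ℝ) := p.2.1
  rw [variance_eq_integral (measurable_of_finite _).aemeasurable]
  set c := ∫ z, stateSign z ∂(agentStep p x u).toMeasure
  rw [integral_agentStep p x u (fun z => (stateSign z - c) ^ 2), sum_agentState]
  have q1 := le_seenProb hp x (some .alpha)
  have q2 := le_seenProb hp x (some .beta)
  have q3 := le_seenProb hp x none
  rcases x u with _ | (_ | _) <;>
    simp only [usdUpdate, stateSign, if_true, reduceCtorEq, if_false]
  · have h1 := mul_le_mul_of_nonneg_right q1 (sq_nonneg (1 - c))
    have h2 := mul_le_mul_of_nonneg_right q2 (sq_nonneg (-1 - c))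
    have h3 := mul_le_mul_of_nonneg_right q3 (sq_nonneg (0 - c))
    nlinarith [mul_nonneg h0.le (sq_nonneg (1 - 2 * c)), mul_nonneg h0.le (sq_nonneg (-1 - c))]
  · have h1 := mul_le_mul_of_nonneg_right q1 (sq_nonneg (1 - c))
    have h2 := mul_le_mul_of_nonneg_right q2 (sq_nonneg (0 - c))
    have h3 := mul_le_mul_of_nonneg_right q3 (sq_nonneg (1 - c))
    nlinarith [mul_nonneg h0.le (sq_nonneg (1 - 2 * c)), mul_nonneg h0.le (sq_nonneg (1 - c))]
  · have h1 := mul_le_mul_of_nonneg_right q1 (sq_nonneg (0 - c))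
    have h2 := mul_le_mul_of_nonneg_right q2 (sq_nonneg (-1 - c))
    have h3 := mul_le_mul_of_nonneg_right q3 (sq_nonneg (-1 - c))
    nlinarith [mul_nonneg h0.le (sq_nonneg (1 + 2 * c)), mul_nonneg h0.le (sq_nonneg (-1 - c))]

/-- One round takes the configuration `x` to `y` with the relative bias and the undecided fraction
within `η` of their expectations. -/
def IsTypicalRound (p : NoiseProb) (η : ℝ) (x y : Config V) : Prop :=
  NearDrift p η (relBias x) (relUndecided x) (relBias y) (relUndecided y)

lemma roundKernel_not_typical_le (p : NoiseProb) (x : Config V) {η : ℝ} (hη : 0 < η) :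
    roundKernel p x {y | ¬ IsTypicalRound p η x y} ≤
      ENNReal.ofReal (2 / (η ^ 2 * Fintype.card V)) := by
  have hV : (0 : ℝ) < Fintype.card V := by positivity
  have h1 := measure_sum_pi_deviation_le (μ := fun u => (agentStep p x u).toMeasure)
    abs_stateSign_le hη
  have h2 := measure_sum_pi_deviation_le (μ := fun u => (agentStep p x u).toMeasure)
    abs_undecidedInd_le hη
  rw [← roundKernel_apply, sum_integral_stateSign] at h1
  rw [← roundKernel_apply, sum_integral_undecidedInd] at h2
  simp only [sum_stateSign] at h1
  simp only [sum_undecidedInd] at h2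
  have hdev : ∀ a d : ℝ, ¬ |a / Fintype.card V - d| ≤ η →
      η * Fintype.card V ≤ |a - Fintype.card V * d| := by
    intro a d h
    rw [not_le] at h
    have e : a - Fintype.card V * d = (a / Fintype.card V - d) * Fintype.card V := by
      field_simp
    rw [e, abs_mul, abs_of_pos hV]
    gcongr
  calc _ ≤ roundKernel p x ({y | η * Fintype.card V ≤
          |(bias y : ℝ) - Fintype.card V * driftBias p (relBias x) (relUndecided x)|} ∪
        {y | η * Fintype.card V ≤ |(stateCount y none : ℝ) -
          Fintype.card V * driftUndecided p (relBias x) (relUndecided x)|}) := by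
        refine measure_mono fun y hy => ?_
        rcases not_and_or.1 hy with h | h
        · exact Or.inl (hdev _ _ h)
        · exact Or.inr (hdev _ _ h)
    _ ≤ _ := measure_union_le _ _
    _ ≤ ENNReal.ofReal (1 / (η ^ 2 * Fintype.card V)) +
        ENNReal.ofReal (1 / (η ^ 2 * Fintype.card V)) := add_le_add h1 h2
    _ = _ := by
        rw [← ENNReal.ofReal_add (by positivity) (by positivity)]
        congr 1; ring

/-- The Lyapunov function of the symmetry-breaking phase: it is small when the bias is large
compared with the square root of the number of agents. -/
noncomputable def balance (K : ℝ) (x : Config V) : ℝ :=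
  1 / (K + (bias x : ℝ) ^ 2 / Fintype.card V)

lemma integral_balance_le {p : NoiseProb} (hp : (p : ℝ) ≤ 1 / 3) {e K : ℝ} (he : 0 < e)
    (he1 : e ≤ 1) (hK : 32 ≤ e * K) (hKp : 768 ≤ p * K) {x : Config V}
    (hx : relBias x ^ 2 ≤ (1 - e) * driftBias p (relBias x) (relUndecided x) ^ 2) :
    ∫ y, balance K y ∂(roundKernel p x) ≤
      (1 - min ((p : ℝ) / 2 / (2 * K)) (e / 2)) * balance K x := by
  have hV : (0 : ℝ) < Fintype.card V := by positivity
  have hp0 : 0 < (p : ℝ) := p.2.1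
  have hsq : √(Fintype.card V : ℝ) ^ 2 = Fintype.card V := Real.sq_sqrt hV.le
  have hsp : 0 < √(Fintype.card V : ℝ) := Real.sqrt_pos.2 hV
  set d := driftBias p (relBias x) (relUndecided x) with hd
  have hmean : ∫ y : Config V, (bias y : ℝ) ∂(roundKernel p x) = Fintype.card V * d := by
    have := integral_sum_pi (μ := fun u => (agentStep p x u).toMeasure) stateSign
    rw [← roundKernel_apply, sum_integral_stateSign] at this
    simpa only [sum_stateSign] using this
  have hvar : Var[fun y : Config V => (bias y : ℝ); roundKernel p x] =
      ∑ u, Var[stateSign; (agentStep p x u).toMeasure] := by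
    have := variance_sum_pi_eq (μ := fun u => (agentStep p x u).toMeasure) stateSign
    rw [← roundKernel_apply] at this
    simpa only [sum_stateSign] using this
  have hfour : ∫ y : Config V, (((bias y : ℝ) - Fintype.card V * d) / √(Fintype.card V)) ^ 4
      ∂(roundKernel p x) ≤ 96 := by
    have := integral_pow_four_sum_pi_le (μ := fun u => (agentStep p x u).toMeasure)
      abs_stateSign_le
    rw [← roundKernel_apply, sum_integral_stateSign] at this
    simpa only [sum_stateSign] using this
  have hv : ∫ y : Config V, (((bias y : ℝ) - Fintype.card V * d) / √(Fintype.card V)) ^ 2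
      ∂(roundKernel p x) = (∑ u, Var[stateSign; (agentStep p x u).toMeasure]) /
        Fintype.card V := by
    rw [← hvar, variance_eq_integral (measurable_of_finite _).aemeasurable, hmean,
      ← integral_div]
    simp only [div_pow, hsq]
  -- The scale √n gives the noise variance between p/2 and 1. With fourth moment at most 96, the
  -- requirement 4m ≤ σK reads 768 ≤ pK.
  have h := integral_inv_add_sq_le (ν := roundKernel p x)
    (Y := fun y : Config V => ((bias y : ℝ) - Fintype.card V * d) / √(Fintype.card V))
    (x := √(Fintype.card V) * relBias x) (μ := √(Fintype.card V) * d) (e := e) (K := K)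
    (σ := (p : ℝ) / 2) (m := 96) ?_ hv (by positivity) ?_ ?_ hfour he he1 ?_ hK (by linarith)
  · convert h using 2
    · ext y
      rw [balance]
      congr 2
      have : √(Fintype.card V : ℝ) * d + ((bias y : ℝ) - Fintype.card V * d) / √(Fintype.card V)
          = bias y / √(Fintype.card V) := by
        field_simp
        rw [hsq]; ring
      rw [this, div_pow, hsq]
    · rw [balance, relBias]
      congr 2
      rw [mul_pow, hsq]
      field_simp
  · rw [integral_div, integral_sub Integrable.of_finite Integrable.of_finite, hmean]
    simp
  · rw [le_div_iff₀ hV]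
    calc (p : ℝ) / 2 * Fintype.card V = ∑ _u : V, (p : ℝ) / 2 := by
          rw [Finset.sum_const, Finset.card_univ, nsmul_eq_mul, mul_comm]
      _ ≤ _ := Finset.sum_le_sum fun u _ => le_variance_stateSign hp x u
  · rw [div_le_one hV]
    calc _ ≤ ∑ _u : V, (1 : ℝ) :=
          Finset.sum_le_sum fun u _ => variance_le_one_of_abs_le_one abs_stateSign_le
      _ = _ := by simp
  · rw [mul_pow, mul_pow, hsq]
    nlinarith

end Dynamics

/-! ### Estimates along trajectories. -/

section Dynamics

variable {V : Type} [Fintype V] [Nonempty V]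

instance (p : NoiseProb) (x : Config V) : IsProbabilityMeasure (usdProcess p x) :=
  inferInstanceAs (IsProbabilityMeasure (Kernel.trajMeasure (X := fun _ => Config V) _ _))

/-- The Markov property: conditionally on the history, the next configuration follows the round
kernel. -/
lemma lintegral_usdProcess_step (p : NoiseProb) (x : Config V) (t : ℕ)
    (F : ((i : Finset.Iic t) → Config V) → Config V → ENNReal) :
    ∫⁻ X, F (Preorder.frestrictLe t X) (X (t + 1)) ∂(usdProcess p x) =
      ∫⁻ X, ∫⁻ y, F (Preorder.frestrictLe t X) y ∂(roundKernel p (X t)) ∂(usdProcess p x) := by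
  have h := Kernel.map_frestrictLe_trajMeasure_compProd_eq_map_trajMeasure
    (X := fun _ => Config V) (μ₀ := Measure.dirac x) (a := t)
    (κ := fun t => (roundKernel p).comap
      (fun h : (i : Finset.Iic t) → Config V => h ⟨t, Finset.mem_Iic.2 le_rfl⟩)
      (measurable_pi_apply _))
  have hm : Measurable fun q : ((i : Finset.Iic t) → Config V) × Config V => F q.1 q.2 :=
    measurable_of_finite _
  have h' := congrArg (fun ν => ∫⁻ q, F q.1 q.2 ∂ν) h
  rw [Measure.lintegral_compProd hm, lintegral_map (measurable_of_finite _) (by fun_prop),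
    lintegral_map hm (by fun_prop)] at h'
  exact h'.symm

lemma usdProcess_not_typical_le (p : NoiseProb) (x : Config V) {η : ℝ} (hη : 0 < η) (t : ℕ) :
    usdProcess p x {X | ¬ IsTypicalRound p η (X t) (X (t + 1))} ≤
      ENNReal.ofReal (2 / (η ^ 2 * Fintype.card V)) := by
  classical
  have h := lintegral_usdProcess_step p x t fun h y =>
    {y | ¬ IsTypicalRound p η (h ⟨t, Finset.mem_Iic.2 le_rfl⟩) y}.indicator 1 y
  have hs : MeasurableSet {X : ℕ → Config V | ¬ IsTypicalRound p η (X t) (X (t + 1))} :=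
    (MeasurableSet.of_discrete (s := {q : Config V × Config V |
      ¬ IsTypicalRound p η q.1 q.2})).preimage (f := fun X : ℕ → Config V => (X t, X (t + 1)))
        (by fun_prop)
  rw [← lintegral_indicator_one hs]
  refine (le_of_eq h).trans ?_
  refine (lintegral_mono (g := fun _ => ENNReal.ofReal (2 / (η ^ 2 * Fintype.card V)))
    fun X => ?_).trans (by simp)
  rw [lintegral_indicator_one MeasurableSet.of_discrete]
  exact roundKernel_not_typical_le p (X t) hη

lemma usdProcess_exists_not_typical_le (p : NoiseProb) (x : Config V) {η : ℝ} (hη : 0 < η)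
    (H : ℕ) :
    usdProcess p x {X | ∃ t < H, ¬ IsTypicalRound p η (X t) (X (t + 1))} ≤
      ENNReal.ofReal (H * (2 / (η ^ 2 * Fintype.card V))) := by
  have e : {X : ℕ → Config V | ∃ t < H, ¬ IsTypicalRound p η (X t) (X (t + 1))} =
      ⋃ t ∈ Finset.range H, {X | ¬ IsTypicalRound p η (X t) (X (t + 1))} := by
    ext X; simp
  rw [e]
  refine (measure_biUnion_finset_le _ _).trans
    ((Finset.sum_le_sum fun t _ => usdProcess_not_typical_le p x hη t).trans (le_of_eq ?_))
  rw [Finset.sum_const, Finset.card_range, nsmul_eq_mul, ENNReal.ofReal_mul (by positivity),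
    ENNReal.ofReal_natCast]

/-- In configuration `x`, the expected bias after one round exceeds the present one by a constant
factor. -/
def Expands (p : NoiseProb) (e : ℝ) (x : Config V) : Prop :=
  relBias x ^ 2 ≤ (1 - e) * driftBias p (relBias x) (relUndecided x) ^ 2

/-- The trajectories along which the bias is expected to grow in the rounds `1, …, k`. -/
def expandingUpTo (V : Type) [Fintype V] (p : NoiseProb) (e : ℝ) (k : ℕ) :
    Set (ℕ → Config V) :=
  {X | ∀ i, 1 ≤ i → i ≤ k → Expands p e (X i)}

lemma balance_nonneg {K : ℝ} (hK : 0 < K) (x : Config V) : 0 ≤ balance K x := by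
  unfold balance; positivity

lemma balance_le {K : ℝ} (hK : 0 < K) (x : Config V) : balance K x ≤ 1 / K := by
  unfold balance
  gcongr
  have : 0 ≤ (bias x : ℝ) ^ 2 / Fintype.card V := by positivity
  linarith

lemma le_balance {K : ℝ} (hK : 0 < K) (x : Config V) :
    1 / (K + Fintype.card V) ≤ balance K x := by
  have hV : (0 : ℝ) < Fintype.card V := by positivity
  unfold balance
  gcongr
  have h := abs_relBias_le x
  have hu := relUndecided_nonneg x
  rw [relBias, abs_div, abs_of_pos hV, div_le_iff₀ hV] at h
  have h' : |(bias x : ℝ)| ≤ Fintype.card V := by nlinarith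
  rw [div_le_iff₀ hV, ← sq_abs]
  nlinarith [abs_nonneg (bias x : ℝ)]

lemma measurableSet_expandingUpTo {V : Type} [Fintype V] (p : NoiseProb) (e : ℝ) (k : ℕ) :
    MeasurableSet (expandingUpTo V p e k) := by
  have : expandingUpTo V p e k =
      ⋂ i, ⋂ (_ : 1 ≤ i), ⋂ (_ : i ≤ k), (fun X : ℕ → Config V => X i) ⁻¹' {y | Expands p e y} := by
    ext X; simp [expandingUpTo]
  rw [this]
  exact .iInter fun i => .iInter fun _ => .iInter fun _ =>
    measurable_pi_apply i (MeasurableSet.of_discrete)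

lemma lintegral_balance_le {p : NoiseProb} (hp : (p : ℝ) ≤ 1 / 3) {e K : ℝ} (he : 0 < e)
    (he1 : e ≤ 1) (hK : 32 ≤ e * K) (hKp : 768 ≤ p * K) {x : Config V} (hx : Expands p e x) :
    ∫⁻ y, ENNReal.ofReal (balance K y) ∂(roundKernel p x) ≤
      ENNReal.ofReal (1 - min ((p : ℝ) / 2 / (2 * K)) (e / 2)) * ENNReal.ofReal (balance K x) := by
  have hK0 : 0 < K := by nlinarith
  rw [← ENNReal.ofReal_mul' (balance_nonneg hK0 x), ← ofReal_integral_eq_lintegral_ofReal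
    Integrable.of_finite (ae_of_all _ fun y => balance_nonneg hK0 y)]
  exact ENNReal.ofReal_le_ofReal (integral_balance_le hp he he1 hK hKp hx)

/-- A supermartingale argument: the events decrease in k, and on each of them the next round
contracts the potential. It starts in round 1, because the initial undecided fraction is
uncontrolled. -/
lemma lintegral_indicator_balance_le {p : NoiseProb} (hp : (p : ℝ) ≤ 1 / 3) {e K : ℝ}
    (he : 0 < e) (he1 : e ≤ 1) (hK : 32 ≤ e * K) (hKp : 768 ≤ p * K) (x : Config V) (k : ℕ) :
    ∫⁻ X, (expandingUpTo V p e k).indicator 1 X * ENNReal.ofReal (balance K (X (k + 1)))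
        ∂(usdProcess p x) ≤
      ENNReal.ofReal (1 - min ((p : ℝ) / 2 / (2 * K)) (e / 2)) ^ k * ENNReal.ofReal (1 / K) := by
  classical
  have hK0 : 0 < K := by nlinarith
  induction k with
  | zero =>
    refine (lintegral_mono (g := fun _ => ENNReal.ofReal (1 / K)) fun X => ?_).trans (by simp)
    refine (mul_le_mul' (Set.indicator_le_self' (fun _ _ => zero_le) X)
      (ENNReal.ofReal_le_ofReal (balance_le hK0 _))).trans (by simp)
  | succ k ih =>
    -- The event rewritten in terms of the history up to k + 1, as the Markov property requires.
    let D : Set ((i : Finset.Iic (k + 1)) → Config V) :=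
      {h | ∀ i : Finset.Iic (k + 1), 1 ≤ (i : ℕ) → Expands p e (h i)}
    have hi : ∀ X : ℕ → Config V, (expandingUpTo V p e (k + 1)).indicator (1 : (ℕ → Config V) → ENNReal) X =
        D.indicator 1 (Preorder.frestrictLe (k + 1) X) := by
      intro X
      have hiff : X ∈ expandingUpTo V p e (k + 1) ↔ Preorder.frestrictLe (k + 1) X ∈ D :=
        ⟨fun h i h1 => h i h1 (Finset.mem_Iic.1 i.2),
          fun h i h1 h2 => h ⟨i, Finset.mem_Iic.2 h2⟩ h1⟩
      by_cases hX : X ∈ expandingUpTo V p e (k + 1)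
      · rw [Set.indicator_of_mem hX, Set.indicator_of_mem (hiff.1 hX)]; rfl
      · rw [Set.indicator_of_notMem hX, Set.indicator_of_notMem (hiff.not.1 hX)]
    simp_rw [hi]
    rw [lintegral_usdProcess_step p x (k + 1) fun h y =>
      D.indicator 1 h * ENNReal.ofReal (balance K y)]
    simp_rw [← hi]
    rw [pow_succ', mul_assoc]
    refine le_trans ?_ (mul_le_mul_right ih _)
    rw [← lintegral_const_mul' _ _ ENNReal.ofReal_ne_top]
    refine lintegral_mono fun X => ?_
    rw [lintegral_const_mul _ (measurable_of_finite _)]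
    by_cases hX : X ∈ expandingUpTo V p e (k + 1)
    · have hX' : X ∈ expandingUpTo V p e k := fun i h1 h2 => hX i h1 (by omega)
      simp only [Set.indicator_of_mem hX, Set.indicator_of_mem hX', Pi.one_apply, one_mul]
      exact lintegral_balance_le hp he he1 hK hKp (hX (k + 1) (by omega) le_rfl)
    · simp [Set.indicator_of_notMem hX]

/-- Markov's inequality: the potential is never below 1/(K+n), so its small expectation on the event
bounds the probability. -/
lemma usdProcess_expandingUpTo_le {p : NoiseProb} (hp : (p : ℝ) ≤ 1 / 3) {e K : ℝ}
    (he : 0 < e) (he1 : e ≤ 1) (hK : 32 ≤ e * K) (hKp : 768 ≤ p * K) (x : Config V) (k : ℕ) :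
    (usdProcess p x).real (expandingUpTo V p e k) ≤
      (1 - min ((p : ℝ) / 2 / (2 * K)) (e / 2)) ^ k * ((K + Fintype.card V) / K) := by
  have hK0 : 0 < K := by nlinarith
  have hV : (0 : ℝ) < Fintype.card V := by positivity
  have hc : 0 ≤ 1 - min ((p : ℝ) / 2 / (2 * K)) (e / 2) := by
    have := min_le_right ((p : ℝ) / 2 / (2 * K)) (e / 2)
    linarith
  have h1 : usdProcess p x (expandingUpTo V p e k) * ENNReal.ofReal (1 / (K + Fintype.card V)) ≤
      ENNReal.ofReal (1 - min ((p : ℝ) / 2 / (2 * K)) (e / 2)) ^ k * ENNReal.ofReal (1 / K) := by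
    refine le_trans ?_ (lintegral_indicator_balance_le hp he he1 hK hKp x k)
    rw [← lintegral_indicator_one (measurableSet_expandingUpTo p e k),
      ← lintegral_mul_const' _ _ ENNReal.ofReal_ne_top]
    exact lintegral_mono fun X =>
      mul_le_mul_right (ENNReal.ofReal_le_ofReal (le_balance hK0 _)) _
  have h2 := ENNReal.toReal_mono (by finiteness) h1
  rw [ENNReal.toReal_mul, ENNReal.toReal_mul, ENNReal.toReal_pow, ENNReal.toReal_ofReal hc,
    ENNReal.toReal_ofReal (by positivity), ENNReal.toReal_ofReal (by positivity)] at h2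
  rw [measureReal_def]
  rw [mul_one_div, div_le_iff₀ (by positivity)] at h2
  refine h2.trans (le_of_eq ?_)
  ring

end Dynamics

/-! ### Combining the two phases. -/

lemma isMajority_alpha {V : Type} [Fintype V] {x : Config V} (h : 0 < bias x) :
    IsMajority .alpha x := by
  rintro (_ | _) hk
  · exact absurd rfl hk
  · unfold bias at h; omega

lemma isMajority_beta {V : Type} [Fintype V] {x : Config V} (h : bias x < 0) :
    IsMajority .beta x := by
  rintro (_ | _) hk
  · unfold bias at h; omega
  · exact absurd rfl hk

section Dynamics

variable {V : Type} [Fintype V] [Nonempty V] {ε : ℝ}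

/-- The number of rounds needed to enter the metastable range from a relative bias of at least
`√ε / 4`, along typical rounds. -/
noncomputable def entryTime (h0 : 0 < ε) (h6 : ε < 1 / 6) : ℕ :=
  (exists_time_metastable h0 h6).choose

/-- The sign of the bias at t₀ selects the opinion; a negative bias reduces to a positive one by
`NearDrift.neg`. -/
lemma metastable_of_typical (h0 : 0 < ε) (h6 : ε < 1 / 6) {p : NoiseProb}
    (hp : (p : ℝ) = 1 / 6 - ε) {X : ℕ → Config V} {t₀ H : ℕ}
    (hX : ∀ t < H, IsTypicalRound p (noiseTol ε) (X t) (X (t + 1)))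
    (hb : √ε / 4 < |relBias (X t₀)|) :
    ∃ j : Opinion, ∀ t, t₀ + entryTime h0 h6 ≤ t → t ≤ H →
      IsMajority j (X t) ∧ |(bias (X t) : ℝ)| ∈ deltaRange ε (Fintype.card V) := by
  have hV : (0 : ℝ) < Fintype.card V := by positivity
  have hlow : 0 < 2 * √ε / (1 + 6 * ε) := by positivity
  have spec := (exists_time_metastable h0 h6).choose_spec
  have hstep : ∀ k < H - t₀, NearDrift (1 / 6 - ε) (noiseTol ε) (relBias (X (t₀ + k)))
      (relUndecided (X (t₀ + k))) (relBias (X (t₀ + (k + 1)))) (relUndecided (X (t₀ + (k + 1)))) := by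
    intro k hk
    rw [← hp]
    exact hX (t₀ + k) (by omega)
  have hw0 : ∀ k, 0 ≤ relUndecided (X (t₀ + k)) := fun k => relUndecided_nonneg _
  have hsw : ∀ k, |relBias (X (t₀ + k))| ≤ 1 - relUndecided (X (t₀ + k)) :=
    fun k => abs_relBias_le _
  rcases lt_abs.1 hb with h | h
  · refine ⟨.alpha, fun t ht htH => ?_⟩
    obtain ⟨k, rfl⟩ := Nat.exists_eq_add_of_le (by omega : t₀ ≤ t)
    have := spec (H - t₀) (fun k => relBias (X (t₀ + k))) (fun k => relUndecided (X (t₀ + k)))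
      h.le hw0 hsw hstep k (by unfold entryTime at ht; omega) (by omega)
    simp only [relBias] at this
    rw [le_div_iff₀ hV, div_le_iff₀ hV] at this
    have hpos : (0 : ℝ) < bias (X (t₀ + k)) := (mul_pos hlow hV).trans_le this.1
    refine ⟨isMajority_alpha (by exact_mod_cast hpos), ?_⟩
    rw [abs_of_pos hpos]
    exact this
  · refine ⟨.beta, fun t ht htH => ?_⟩
    obtain ⟨k, rfl⟩ := Nat.exists_eq_add_of_le (by omega : t₀ ≤ t)
    have := spec (H - t₀) (fun k => -relBias (X (t₀ + k))) (fun k => relUndecided (X (t₀ + k)))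
      h.le hw0 (fun k => by rw [abs_neg]; exact hsw k) (fun k hk => (hstep k hk).neg) k
      (by unfold entryTime at ht; omega) (by omega)
    simp only [relBias, ← neg_div] at this
    rw [le_div_iff₀ hV, div_le_iff₀ hV] at this
    have hneg : (bias (X (t₀ + k)) : ℝ) < 0 :=
      neg_pos.1 ((mul_pos hlow hV).trans_le this.1)
    refine ⟨isMajority_beta (by exact_mod_cast hneg), ?_⟩
    rw [abs_of_neg hneg]
    exact this

/-- By `growth_small`, a small bias in a typical round forces expansion in the round after it. So a
failure of expansion reveals a large bias one round earlier. -/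
lemma exists_large_bias {V : Type} [Fintype V] {ε : ℝ} (h0 : 0 < ε) (h6 : ε < 1 / 6) {p : NoiseProb}
    (hp : (p : ℝ) = 1 / 6 - ε) {X : ℕ → Config V} {k H : ℕ} (hkH : k ≤ H)
    (hX : ∀ t < H, IsTypicalRound p (noiseTol ε) (X t) (X (t + 1)))
    (hk : X ∉ expandingUpTo V p ε k) : ∃ t₀ < k, √ε / 4 < |relBias (X t₀)| := by
  simp only [expandingUpTo, Set.mem_ofPred_eq, not_forall] at hk
  obtain ⟨i, h1, hik, hne⟩ := hk
  obtain ⟨i, rfl⟩ := Nat.exists_eq_succ_of_ne_zero (by omega : i ≠ 0)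
  refine ⟨i, by omega, ?_⟩
  by_contra! hs
  apply hne
  have := hX i (by omega)
  unfold IsTypicalRound at this
  unfold Expands
  rw [hp] at this ⊢
  exact growth_small h0 h6 hs this

lemma usdProcess_metastable_ge (h0 : 0 < ε) (h6 : ε < 1 / 6) {p : NoiseProb}
    (hp : (p : ℝ) = 1 / 6 - ε) {K : ℝ} (hK : 32 ≤ ε * K) (hKp : 768 ≤ p * K) (x : Config V)
    (k L : ℕ) :
    1 - (((k + entryTime h0 h6 + L : ℕ) : ℝ) * (2 / (noiseTol ε ^ 2 * Fintype.card V)) +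
        (1 - min ((p : ℝ) / 2 / (2 * K)) (ε / 2)) ^ k * ((K + Fintype.card V) / K)) ≤
      (usdProcess p x).real {X | ∃ T : ℕ, T ≤ k + entryTime h0 h6 ∧ ∃ j : Opinion,
        ∀ t, T ≤ t → t ≤ T + L →
          IsMajority j (X t) ∧ |(bias (X t) : ℝ)| ∈ deltaRange ε (Fintype.card V)} := by
  set H := k + entryTime h0 h6 + L with hH
  set S := {X : ℕ → Config V | ∃ T : ℕ, T ≤ k + entryTime h0 h6 ∧ ∃ j : Opinion,
        ∀ t, T ≤ t → t ≤ T + L →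
          IsMajority j (X t) ∧ |(bias (X t) : ℝ)| ∈ deltaRange ε (Fintype.card V)}
  set B := {X : ℕ → Config V | ∃ t < H, ¬ IsTypicalRound p (noiseTol ε) (X t) (X (t + 1))}
  -- Every trajectory succeeds, has an atypical round, or keeps expanding for k rounds; the last two
  -- events are rare.
  have hcover : Set.univ ⊆ S ∪ (B ∪ expandingUpTo V p ε k) := by
    intro X _
    by_contra hX
    simp only [Set.mem_union, not_or] at hX
    obtain ⟨hS, hB, hE⟩ := hX
    have hB' : ∀ t < H, IsTypicalRound p (noiseTol ε) (X t) (X (t + 1)) := by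
      intro t ht
      by_contra hc
      exact hB ⟨t, ht, hc⟩
    obtain ⟨t₀, ht₀, hb⟩ := exists_large_bias h0 h6 hp (by omega) hB' hE
    obtain ⟨j, hj⟩ := metastable_of_typical h0 h6 hp hB' hb
    exact hS ⟨t₀ + entryTime h0 h6, by omega, j, fun t h1 h2 => hj t h1 (by omega)⟩
  have h1 : (1 : ℝ) ≤ (usdProcess p x).real (S ∪ (B ∪ expandingUpTo V p ε k)) := by
    rw [← probReal_univ (μ := usdProcess p x)]
    exact measureReal_mono hcover
  have h2 := measureReal_union_le (μ := usdProcess p x) S (B ∪ expandingUpTo V p ε k)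
  have h3 := measureReal_union_le (μ := usdProcess p x) B (expandingUpTo V p ε k)
  have h4 : (usdProcess p x).real B ≤ H * (2 / (noiseTol ε ^ 2 * Fintype.card V)) :=
    ENNReal.toReal_le_of_le_ofReal (by positivity)
      (usdProcess_exists_not_typical_le p x (noiseTol_pos h0 h6) H)
  have h5 := usdProcess_expandingUpTo_le (by linarith : (p : ℝ) ≤ 1 / 3) h0 (by linarith) hK hKp x k
  linarith

end Dynamics

/-- With r = n^(1/4), the number of rounds is O(r²), since log n ≤ 2r² and L ≤ r². The expanding
event costs n⁻² · 2n = 2/n. The total is at most D r²/n, and D ≤ r turns this into r³/n = 1/r. -/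
lemma failure_le_rpow {D a K c n : ℝ} {T₀ k L : ℕ} (hc : 0 < c) (hc1 : c ≤ 1) (hK : 1 ≤ K)
    (ha : 0 ≤ a) (hn : 1 ≤ n) (hD : D = (4 / c + 2 + T₀) * a + 2)
    (hDn : D ^ 4 ≤ n) (hk : 2 / c * Real.log n ≤ k) (hk' : (k : ℝ) ≤ 2 / c * Real.log n + 1)
    (hL : (L : ℝ) ≤ n ^ (1 / 2 : ℝ)) :
    ((k + T₀ + L : ℕ) : ℝ) * (a / n) + (1 - c) ^ k * ((K + n) / K) ≤ (1 / n) ^ (1 / 4 : ℝ) := by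
  have hn0 : 0 < n := by linarith
  set r := n ^ (1 / 4 : ℝ) with hr
  have hr0 : 0 < r := by positivity
  have hr1 : 1 ≤ r := Real.one_le_rpow hn (by norm_num)
  have hr4 : r ^ 4 = n := by
    rw [hr, ← Real.rpow_natCast, ← Real.rpow_mul hn0.le]; norm_num
  have hr2 : n ^ (1 / 2 : ℝ) = r ^ 2 := by
    rw [hr, ← Real.rpow_natCast, ← Real.rpow_mul hn0.le]; norm_num
  have hlog : Real.log n ≤ 2 * r ^ 2 := by
    have := Real.log_le_rpow_div hn0.le (by norm_num : (0 : ℝ) < 1 / 2)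
    rw [hr2] at this; linarith
  have hlog0 : 0 ≤ Real.log n := Real.log_nonneg hn
  have hci : 0 < 2 / c := by positivity
  have hD0 : 0 ≤ D := by rw [hD]; positivity
  have hDr : D ≤ r := by
    rw [← hr4] at hDn
    exact le_of_pow_le_pow_left₀ (by norm_num) hr0.le hDn
  have hpow : (1 - c) ^ k ≤ 1 / n ^ 2 := by
    calc (1 - c) ^ k ≤ Real.exp (-c) ^ k := by
          refine pow_le_pow_left₀ (by linarith) ?_ k
          linarith [Real.add_one_le_exp (-c)]
      _ = Real.exp (-(c * k)) := by rw [← Real.exp_nat_mul]; ring_nf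
      _ ≤ Real.exp (-(2 * Real.log n)) := by
          apply Real.exp_le_exp.2
          have := mul_le_mul_of_nonneg_left hk hc.le
          have e : c * (2 / c * Real.log n) = 2 * Real.log n := by field_simp
          linarith
      _ = 1 / n ^ 2 := by
          rw [Real.exp_neg, two_mul, Real.exp_add, Real.exp_log hn0, one_div, sq]
  have hfrac : (K + n) / K ≤ 2 * n := by
    rw [div_le_iff₀ (by linarith)]
    nlinarith
  have hsecond : (1 - c) ^ k * ((K + n) / K) ≤ 2 / n := by
    calc _ ≤ 1 / n ^ 2 * (2 * n) := by gcongr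
      _ = 2 / n := by field_simp
  have hr22 : 1 ≤ r ^ 2 := one_le_pow₀ hr1
  have hfirst : ((k + T₀ + L : ℕ) : ℝ) * a + 2 ≤ D * r ^ 2 := by
    push_cast
    have hT : (T₀ : ℝ) ≤ T₀ * r ^ 2 := le_mul_of_one_le_right (by positivity) hr22
    have hkr : (k : ℝ) ≤ 2 / c * (2 * r ^ 2) + r ^ 2 :=
      hk'.trans (add_le_add (mul_le_mul_of_nonneg_left hlog hci.le) hr22)
    rw [hr2] at hL
    have : ((k : ℝ) + T₀ + L) * a ≤ ((4 / c + 2 + T₀) * r ^ 2) * a :=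
      mul_le_mul_of_nonneg_right (by rw [show 4 / c = 2 / c * 2 by ring]; linarith) ha
    rw [hD]
    nlinarith [mul_nonneg ha (sq_nonneg r)]
  calc _ ≤ ((k + T₀ + L : ℕ) : ℝ) * (a / n) + 2 / n := by linarith
    _ = (((k + T₀ + L : ℕ) : ℝ) * a + 2) / n := by ring
    _ ≤ r * r ^ 2 / n := by gcongr; exact hfirst.trans (by gcongr)
    _ = (1 / n) ^ (1 / 4 : ℝ) := by
        rw [Real.div_rpow (by norm_num) hn0.le, Real.one_rpow, ← hr, ← hr4]
        field_simp

theorem theorem3 (ε : ℝ) (hε : ε ∈ Set.Ioo (0 : ℝ) (1 / 6))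
    (p : NoiseProb) (hp : (p : ℝ) = 1 / 6 - ε) :
    ∃ C > (0 : ℝ), ∃ c > (0 : ℝ), ∃ lam > (0 : ℝ), ∃ γ > (0 : ℝ), ∃ N : ℕ,
      ∀ (n : ℕ) [NeZero n], N ≤ n → ∀ x : Config (Fin n),
        1 - (1 / (n : ℝ)) ^ γ ≤
          (usdProcess p x).real
            {X | ∃ T : ℕ, (T : ℝ) ≤ C * Real.log n ∧ ∃ j : Opinion,
              ∀ t : ℕ, T ≤ t → (t : ℝ) ≤ T + c * (n : ℝ) ^ lam →
                IsMajority j (X t) ∧ (|bias (X t)| : ℝ) ∈ deltaRange ε n} := by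
  obtain ⟨h0, h6⟩ := hε
  have hp0 : 0 < (p : ℝ) := p.2.1
  have hη := noiseTol_pos h0 h6
  set K : ℝ := 32 / ε + 768 / p with hKd
  have hK : 32 ≤ ε * K := by
    have : ε * K = 32 + ε * (768 / p) := by rw [hKd]; field_simp
    rw [this]; have : 0 < ε * (768 / (p : ℝ)) := by positivity
    linarith
  have hKp : 768 ≤ p * K := by
    have : (p : ℝ) * K = p * (32 / ε) + 768 := by rw [hKd]; field_simp
    rw [this]; have : 0 < (p : ℝ) * (32 / ε) := by positivity
    linarith
  have hK1 : 1 ≤ K := by nlinarith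
  set c := min ((p : ℝ) / 2 / (2 * K)) (ε / 2) with hcd
  have hc : 0 < c := lt_min (by positivity) (by positivity)
  have hc1 : c ≤ 1 := (min_le_right _ _).trans (by linarith)
  set T₀ := entryTime h0 h6
  set a : ℝ := 2 / noiseTol ε ^ 2 with had
  have ha : 0 ≤ a := by positivity
  set D : ℝ := (4 / c + 2 + T₀) * a + 2 with hD
  -- In C, the 1 pays for rounding k up and T₀ for the entry time; n ≥ 3 ensures log n ≥ 1, which
  -- absorbs both.
  refine ⟨2 / c + 1 + T₀, by positivity, 1, one_pos, 1 / 2, by norm_num, 1 / 4, by norm_num,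
    max 3 ⌈D ^ 4⌉₊, fun n _ hn x => ?_⟩
  have hn3 : (3 : ℝ) ≤ n := by exact_mod_cast (le_max_left _ _).trans hn
  have hDn : D ^ 4 ≤ n :=
    (Nat.le_ceil _).trans (by exact_mod_cast (le_max_right _ _).trans hn)
  have hlog : 1 ≤ Real.log n := by
    rw [Real.le_log_iff_exp_le (by linarith)]
    linarith [Real.exp_one_lt_d9]
  set k := ⌈2 / c * Real.log n⌉₊ with hkd
  set L := ⌊(n : ℝ) ^ (1 / 2 : ℝ)⌋₊ with hLd
  have hk : 2 / c * Real.log n ≤ k := Nat.le_ceil _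
  have hk' : (k : ℝ) ≤ 2 / c * Real.log n + 1 := (Nat.ceil_lt_add_one (by positivity)).le
  have hL : (L : ℝ) ≤ (n : ℝ) ^ (1 / 2 : ℝ) := Nat.floor_le (by positivity)
  have hmain := usdProcess_metastable_ge h0 h6 hp hK hKp x k L
  have hfail := failure_le_rpow (T₀ := T₀) hc hc1 hK1 ha (by linarith) hD hDn hk hk' hL
  rw [Fintype.card_fin] at hmain
  have e : 2 / (noiseTol ε ^ 2 * (n : ℝ)) = a / n := by rw [had, div_div]
  rw [e] at hmain
  refine (by linarith : _ ≤ _).trans (hmain.trans (measureReal_mono ?_))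
  rintro X ⟨T, hT, j, hj⟩
  refine ⟨T, ?_, j, fun t h1 h2 => hj t h1 ?_⟩
  · have hT' : (T : ℝ) ≤ k + T₀ := by exact_mod_cast hT
    have : (T₀ : ℝ) ≤ T₀ * Real.log n := le_mul_of_one_le_right (by positivity) hlog
    linarith
  · obtain ⟨d, rfl⟩ := Nat.exists_eq_add_of_le h1
    push_cast at h2
    have : d ≤ L := Nat.le_floor (by linarith)
    omega
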